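/- All matrices are complex $d\times d$ matrices; a *state* is a positive semidefinite matrix of trace one, and $\|A\|_1=\operatorname{Tr}\sqrt{A^\dagger A}$ is the trace norm. **Theorem (Reverse Triangle Inequality).** Let $\varepsilon\ge 0$ and let $\rho_1,\dots,\rho_l,\sigma$ be states, of any dimension $d$, with $\|\rho_i-\sigma\|_1\ge 2-\varepsilon$ for $i=1,\dots,l$. Let $(p_i)_{i=1}^l$ be any probability distribution. 1. Then $\bigl\|\sum_{i=1}^l p_i\rho_i-\sigma\bigr\|_1\ge 2-2\sqrt{l\varepsilon}$. 2. If moreover the states $\rho_1,\dots,\rho_l,\sigma$ all commute with each other, then $\bigl\|\sum_{i=1}^l p_i\rho_i-\sigma\bigr\|_1\ge 2-l\varepsilon$. 3. For every $\varepsilon\in[0,2]$ there are, in some dimension $d$, non-commuting states $\rho_1,\rho_2,\sigma$ with $\|\rho_1-\sigma\|_1\ge 2-\varepsilon$ and $\|\rho_2-\sigma\|_1\ge 2-\varepsilon$ such that $$\Bigl\|\frac{\rho_1+\rho_2}{2}-\sigma\Bigr\|_1\le 2-\sqrt{2\varepsilon}.$$ Here "non-commuting" means that no two of the three states commute if $\varepsilon>0$,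 and that $\rho_1$ and $\rho_2$ do not commute if $\varepsilon=0$. Consequently, the dependence on $\sqrt\varepsilon$ cannot be improved: if a function $\varphi$ is such that, for all $\varepsilon\in[0,2]$, all $d$ and all states $\rho_1,\rho_2,\sigma$ of dimension $d$ with $\|\rho_i-\sigma\|_1\ge 2-\varepsilon$ for $i=1,2$, one has $\bigl\|\frac{\rho_1+\rho_2}{2}-\sigma\bigr\|_1\ge 2-\varphi(\varepsilon)$, then $\varphi(\varepsilon)\ge\sqrt{2\varepsilon}$ for all $\varepsilon\in[0,2]$. -/

import Mathlib

open scoped ComplexOrder MatrixOrder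

/-- A state (density matrix): a positive semidefinite complex matrix of trace one. -/
structure IsState {n : Type*} [Fintype n] (ρ : Matrix n n ℂ) : Prop where
  posSemidef : ρ.PosSemidef
  trace_eq_one : ρ.trace = 1

/-- The trace norm `‖A‖₁ = Tr √(A† A)`, where `√` is the positive square root of a positive
semidefinite matrix (the trace is a nonnegative real number, so taking its real part loses
nothing). -/
noncomputable def traceNorm {n : Type*} [Fintype n] [DecidableEq n] (A : Matrix n n ℂ) : ℝ :=
  (CFC.sqrt (A.conjTranspose * A)).trace.re

/-! For Hermitian `H` the trace norm is the maximum of `2 Tr TH - Tr H` over tests `0 ≤ T ≤ 1`,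
attained at the spectral projection of `H` onto `[0, ∞)`. So trace distance at least `2 - ε` means
that some projection `P i` has total error `Tr Pᵢσ + Tr (1 - Pᵢ)ρᵢ ≤ ε/2`.

Arbitrary states: with `τ = ∑ pᵢρᵢ`, `powers_stormer` gives `‖τ - σ‖₁ ≥ 2 - 2 Tr √τ√σ`. By
`exists_sqrt_sum_eq`, `√τ` is a combination of the `√ρᵢ Vᵢ` with contractions `Vᵢ` and weights
`√pᵢ`. Inserting `Pᵢ + (1 - Pᵢ)` and using Cauchy–Schwarz bounds each overlap by `√ε`, and `∑ √pᵢ ≤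
√l`.

Commuting states: the `Pᵢ` commute, so they have a join, and a union bound shows that this single
test has total error at most `lε/2`.

Sharpness: the average of the pure states `(c, ±s, 0)` is diagonal, hence easy to compare with a
diagonal `σ`, while each pure state is separated from `σ` by a test tilted to its own side. -/

lemma Matrix.re_trace_mul_nonneg {n : Type*} [Fintype n] [DecidableEq n] {A B : Matrix n n ℂ}
    (hA : 0 ≤ A) (hB : 0 ≤ B) : 0 ≤ (A * B).trace.re := by
  have h := (nonneg_iff_posSemidef.1 (IsSelfAdjoint.conjugate_nonneg hB
    (CFC.sqrt_nonneg A).isSelfAdjoint)).trace_nonneg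
  rw [Matrix.trace_mul_comm, ← mul_assoc, CFC.sqrt_mul_sqrt_self A hA] at h
  exact (Complex.le_def.1 h).1

lemma Matrix.re_trace_nonneg {n : Type*} [Fintype n] {A : Matrix n n ℂ}
    (hA : 0 ≤ A) : 0 ≤ A.trace.re :=
  (Complex.le_def.1 (Matrix.nonneg_iff_posSemidef.1 hA).trace_nonneg).1

lemma Matrix.re_trace_mul_le {n : Type*} [Fintype n] [DecidableEq n] {A B : Matrix n n ℂ}
    (hA : 0 ≤ A) (hB : B ≤ 1) : (A * B).trace.re ≤ A.trace.re := by
  have h := re_trace_mul_nonneg hA (sub_nonneg.2 hB)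
  simp only [mul_sub, mul_one, trace_sub, Complex.sub_re] at h
  linarith

/-- Cauchy–Schwarz for the Hilbert–Schmidt inner product. -/
lemma Matrix.re_trace_conjTranspose_mul_le {n : Type*} [Fintype n] [DecidableEq n]
    (A B : Matrix n n ℂ) : (A.conjTranspose * B).trace.re ≤
      √((A.conjTranspose * A).trace.re) * √((B.conjTranspose * B).trace.re) := by
  have hAB : (B.conjTranspose * A).trace.re = (A.conjTranspose * B).trace.re := by
    rw [← conjTranspose_conjTranspose A, ← conjTranspose_mul, trace_conjTranspose]
    simp
  have key : ∀ t : ℝ, 0 ≤ (A.conjTranspose * A).trace.re * (t * t) +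
      2 * (A.conjTranspose * B).trace.re * t + (B.conjTranspose * B).trace.re := by
    intro t
    have h := re_trace_nonneg (posSemidef_conjTranspose_mul_self (t • A + B)).nonneg
    simp only [conjTranspose_add, conjTranspose_smul, add_mul, mul_add, trace_add,
      Matrix.smul_mul, Matrix.mul_smul, trace_smul, Complex.add_re, Complex.smul_re, star_trivial, smul_eq_mul, hAB] at h
    linarith
  have hd := discrim_le_zero key
  rw [← Real.sqrt_mul (re_trace_nonneg (posSemidef_conjTranspose_mul_self A).nonneg)]
  apply Real.le_sqrt_of_sq_le
  rw [discrim] at hd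
  nlinarith

/-! ### Spectral projections and the trace norm -/

/-- The spectral projection of a Hermitian matrix onto its nonnegative part. -/
lemma Matrix.IsHermitian.exists_nonneg_projection {n : Type*} [Fintype n] [DecidableEq n]
    {H : Matrix n n ℂ} (hH : H.IsHermitian) :
    ∃ P : Matrix n n ℂ, P.IsHermitian ∧ P * P = P ∧ 0 ≤ P * H ∧ 0 ≤ (P - 1) * H ∧
      ∀ X, Commute X H → Commute X P := by
  have hs : IsSelfAdjoint H := hH
  -- The spectrum is finite, so even a step function is admissible in the continuous functional
  -- calculus.
  have hc : ∀ f : ℝ → ℝ, ContinuousOn f (spectrum ℝ H) :=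
    fun f => H.finite_real_spectrum.continuousOn f
  set f : ℝ → ℝ := fun x => if 0 ≤ x then 1 else 0 with hf
  have h1 : cfc f H * H = cfc (fun x => f x * x) H := by
    conv_lhs => rw [← cfc_id' ℝ H]
    rw [cfc_id' ℝ H, cfc_mul f (fun x => x) H (hc _) (hc _), cfc_id' ℝ H]
  have h2 : (cfc f H - 1) * H = cfc (fun x => f x * x - x) H := by
    rw [sub_mul, one_mul, h1, cfc_sub _ _ H (hc _) (hc _), cfc_id' ℝ H]
  refine ⟨cfc f H, cfc_predicate f H, ?_, ?_, ?_, fun X hX => (hX.symm.cfc_real f).symm⟩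
  · rw [← cfc_mul f f H (hc _) (hc _)]
    congr 1
    ext x
    simp [hf]
  · rw [h1]
    refine cfc_nonneg fun x _ => ?_
    simp only [hf]
    split_ifs <;> simp_all
  · rw [h2]
    refine cfc_nonneg fun x _ => ?_
    simp only [hf]
    split_ifs with h
    · simp
    · simp [(not_le.1 h).le]

lemma Matrix.nonneg_of_projection {n : Type*} [Fintype n] [DecidableEq n]
    {P : Matrix n n ℂ} (h : P.IsHermitian) (hP : P * P = P) : 0 ≤ P := by
  rw [← hP]
  nth_rw 1 [← h.eq]
  exact (posSemidef_conjTranspose_mul_self P).nonneg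

lemma Matrix.one_sub_projection {n : Type*} [Fintype n] [DecidableEq n]
    {P : Matrix n n ℂ} (h : P.IsHermitian) (hP : P * P = P) :
    (1 - P).IsHermitian ∧ (1 - P) * (1 - P) = 1 - P := by
  refine ⟨isHermitian_one.sub h, ?_⟩
  simp only [mul_sub, sub_mul, hP]
  simp

lemma Matrix.projection_le_one {n : Type*} [Fintype n] [DecidableEq n]
    {P : Matrix n n ℂ} (h : P.IsHermitian) (hP : P * P = P) : P ≤ 1 :=
  sub_nonneg.1 (nonneg_of_projection (one_sub_projection h hP).1 (one_sub_projection h hP).2)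

/-- `PH` and `(P - 1)H` are the positive and negative parts of `H`. Their sum `(2P - 1)H` is
positive and squares to `H²`, because `2P - 1` is an involution commuting with `H`; hence it is
`|H|`. -/
lemma traceNorm_eq_of_projection {n : Type*} [Fintype n] [DecidableEq n]
    {H P : Matrix n n ℂ} (hH : H.IsHermitian) (hP : P * P = P) (hpos : 0 ≤ P * H)
    (hneg : 0 ≤ (P - 1) * H) (hc : Commute H P) :
    traceNorm H = 2 * (P * H).trace.re - H.trace.re := by
  have h : CFC.sqrt (H.conjTranspose * H) = P * H + (P - 1) * H := by
    refine CFC.sqrt_unique ?_ (add_nonneg hpos hneg)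
    rw [hH.eq]
    have e : P * H + (P - 1) * H = H * (2 * P - 1) := by
      rw [mul_sub, two_mul, mul_add, hc.eq]; noncomm_ring
    have e' : P * H + (P - 1) * H = (2 * P - 1) * H := by noncomm_ring
    have e'' : (2 * P - 1) * (2 * P - 1) = 1 := by
      have : (2 * P - 1) * (2 * P - 1) = 4 * (P * P) - 4 * P + 1 := by noncomm_ring
      rw [this, hP]; simp
    nth_rw 1 [e]
    rw [e', mul_assoc, ← mul_assoc _ _ H, e'', one_mul]
  rw [traceNorm, h]
  simp [sub_mul]
  ring

/-- Every test `0 ≤ T ≤ 1` bounds the trace norm of a Hermitian matrix from below. -/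
lemma le_traceNorm {n : Type*} [Fintype n] [DecidableEq n] {H T : Matrix n n ℂ}
    (hH : H.IsHermitian) (h0 : 0 ≤ T) (h1 : T ≤ 1) :
    2 * (T * H).trace.re - H.trace.re ≤ traceNorm H := by
  obtain ⟨P, -, hP, hpos, hneg, hc⟩ := hH.exists_nonneg_projection
  rw [traceNorm_eq_of_projection hH hP hpos hneg (hc H (Commute.refl H))]
  have e1 := Matrix.re_trace_mul_nonneg hpos (sub_nonneg.2 h1)
  have e2 := Matrix.re_trace_mul_nonneg hneg h0
  rw [Matrix.trace_mul_comm] at e1 e2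
  simp only [mul_sub, sub_mul, one_mul, Matrix.trace_sub, Complex.sub_re] at e1 e2
  linarith

/-- The trace norm of a difference of positive matrices is at most the sum of their traces. -/
lemma traceNorm_sub_le {n : Type*} [Fintype n] [DecidableEq n] {A B : Matrix n n ℂ}
    (hA : 0 ≤ A) (hB : 0 ≤ B) : traceNorm (A - B) ≤ A.trace.re + B.trace.re := by
  have hH : (A - B).IsHermitian := hA.isSelfAdjoint.sub hB.isSelfAdjoint
  obtain ⟨P, hPh, hP, hpos, hneg, hc⟩ := hH.exists_nonneg_projection
  rw [traceNorm_eq_of_projection hH hP hpos hneg (hc _ (Commute.refl _))]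
  have e1 := Matrix.re_trace_mul_le hA (Matrix.projection_le_one hPh hP)
  have e2 := Matrix.re_trace_mul_nonneg (Matrix.nonneg_of_projection hPh hP) hB
  rw [Matrix.trace_mul_comm] at e1
  simp only [mul_sub, Matrix.trace_sub, Complex.sub_re]
  linarith

/-- The Powers–Størmer inequality, for positive matrices given as squares. -/
lemma powers_stormer {n : Type*} [Fintype n] [DecidableEq n] {A B : Matrix n n ℂ}
    (hA : 0 ≤ A) (hB : 0 ≤ B) :
    (A * A).trace.re + (B * B).trace.re - 2 * (A * B).trace.re ≤ traceNorm (A * A - B * B) := by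
  have sq : ∀ {X : Matrix n n ℂ}, 0 ≤ X → (X * X).IsHermitian := fun {X} hX => by
    have := (Matrix.nonneg_iff_posSemidef.1 hX).isHermitian
    rw [Matrix.IsHermitian, Matrix.conjTranspose_mul, this.eq]
  have hH : (A - B).IsHermitian := hA.isSelfAdjoint.sub hB.isSelfAdjoint
  obtain ⟨P, hPh, hP, hpos, hneg, hc⟩ := hH.exists_nonneg_projection
  have hcc := (hc _ (Commute.refl _)).eq
  refine le_trans ?_ (le_traceNorm ((sq hA).sub (sq hB)) (Matrix.nonneg_of_projection hPh hP)
    (Matrix.projection_le_one hPh hP))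
  -- With `D = A - B`, the gap in the inequality for the test `P` is `Tr (|D| - D)A + Tr (|D| +
  -- D)B`, that is `2 Tr (P - 1)DA + 2 Tr PDB`.
  have e1 := Matrix.re_trace_mul_nonneg hpos hB
  have e2 := Matrix.re_trace_mul_nonneg hneg hA
  have c1 := congrArg (fun X => (X * A).trace.re) hcc
  have c2 := congrArg (fun X => (X * B).trace.re) hcc
  simp only [mul_sub, sub_mul, one_mul, Matrix.trace_sub, Complex.sub_re, mul_assoc] at *
  have t1 : (A * (P * A)).trace = (P * (A * A)).trace := by
    rw [Matrix.trace_mul_comm, mul_assoc]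
  have t2 : (B * (P * B)).trace = (P * (B * B)).trace := by
    rw [Matrix.trace_mul_comm, mul_assoc]
  have t3 : (A * (P * B)).trace = (P * (B * A)).trace := by
    rw [Matrix.trace_mul_comm, mul_assoc]
  have t4 : (B * (P * A)).trace = (P * (A * B)).trace := by
    rw [Matrix.trace_mul_comm, mul_assoc]
  have t5 : (B * A).trace = (A * B).trace := Matrix.trace_mul_comm _ _
  simp only [t1, t2, t3, t4, t5] at *
  linarith

/-! ### States and the tests that separate them -/

lemma IsState.nonneg {n : Type*} [Fintype n] {ρ : Matrix n n ℂ} (h : IsState ρ) : 0 ≤ ρ :=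
  Matrix.nonneg_iff_posSemidef.2 h.posSemidef

lemma IsState.isHermitian {n : Type*} [Fintype n] {ρ : Matrix n n ℂ} (h : IsState ρ) :
    ρ.IsHermitian := h.posSemidef.isHermitian

lemma IsState.re_trace {n : Type*} [Fintype n] {ρ : Matrix n n ℂ} (h : IsState ρ) :
    ρ.trace.re = 1 := by simp [h.trace_eq_one]

lemma Matrix.smul_nonneg_real {n : Type*} [Fintype n] {A : Matrix n n ℂ} {p : ℝ}
    (hp : 0 ≤ p) (hA : 0 ≤ A) : 0 ≤ p • A :=
  nonneg_iff_posSemidef.2 ((nonneg_iff_posSemidef.1 hA).smul hp)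

lemma IsState.sum {n ι : Type*} [Fintype n] [Fintype ι] {ρ : ι → Matrix n n ℂ}
    (h : ∀ i, IsState (ρ i)) {p : ι → ℝ} (hp : ∀ i, 0 ≤ p i) (hp1 : ∑ i, p i = 1) :
    IsState (∑ i, p i • ρ i) where
  posSemidef := Matrix.nonneg_iff_posSemidef.1
    (Finset.sum_nonneg fun i _ => Matrix.smul_nonneg_real (hp i) (h i).nonneg)
  trace_eq_one := by
    simp only [Matrix.trace_sum, Matrix.trace_smul, (h _).trace_eq_one]
    rw [← Finset.sum_smul, hp1, one_smul]

/-- Two states at trace distance `2 - ε` are told apart by a projection with total error `ε / 2`. -/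
lemma IsState.exists_projection {n : Type*} [Fintype n] [DecidableEq n] {ρ σ : Matrix n n ℂ} {ε : ℝ}
    (hρ : IsState ρ) (hσ : IsState σ) (h : 2 - ε ≤ traceNorm (ρ - σ)) :
    ∃ P : Matrix n n ℂ, P.IsHermitian ∧ P * P = P ∧ (∀ X, Commute X (ρ - σ) → Commute X P) ∧
      (P * σ).trace.re + ((1 - P) * ρ).trace.re ≤ ε / 2 := by
  have hH : (ρ - σ).IsHermitian := hρ.isHermitian.sub hσ.isHermitian
  obtain ⟨P, hPh, hP, hpos, hneg, hc⟩ := hH.exists_nonneg_projection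
  refine ⟨P, hPh, hP, hc, ?_⟩
  rw [traceNorm_eq_of_projection hH hP hpos hneg (hc _ (Commute.refl _))] at h
  simp only [mul_sub, sub_mul, one_mul, Matrix.trace_sub, Complex.sub_re, hρ.re_trace,
    hσ.re_trace] at h ⊢
  linarith

/-- A test telling two states apart with total error `δ` bounds their trace distance from below. -/
lemma IsState.le_traceNorm_sub {n : Type*} [Fintype n] [DecidableEq n] {ρ σ T : Matrix n n ℂ} {δ : ℝ}
    (hρ : IsState ρ) (hσ : IsState σ) (h0 : 0 ≤ T) (h1 : T ≤ 1)
    (h : (T * σ).trace.re + ((1 - T) * ρ).trace.re ≤ δ) : 2 - 2 * δ ≤ traceNorm (ρ - σ) := by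
  refine le_trans ?_ (le_traceNorm (hρ.isHermitian.sub hσ.isHermitian) h0 h1)
  simp only [mul_sub, sub_mul, one_mul, Matrix.trace_sub, Complex.sub_re, hρ.re_trace,
    hσ.re_trace] at h ⊢
  linarith

/-- `1 - VV† = (1 - VV†)² + V(1 - V†V)V†`, a sum of two positive terms. -/
lemma Matrix.mul_conjTranspose_le_one {n : Type*} [Fintype n] [DecidableEq n] {V : Matrix n n ℂ}
    (h : V.conjTranspose * V ≤ 1) : V * V.conjTranspose ≤ 1 := by
  have h1 := star_right_conjugate_nonneg (sub_nonneg.2 h) V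
  rw [star_eq_conjTranspose] at h1
  have h2 := (posSemidef_conjTranspose_mul_self (1 - V * V.conjTranspose)).nonneg
  rw [(isHermitian_one.sub (isHermitian_mul_conjTranspose_self V)).eq] at h2
  have h3 := add_nonneg h2 h1
  rw [← sub_nonneg]
  convert h3 using 1
  noncomm_ring

/-- If a projection separates `ρ` from `σ` with total error `ε / 2`, then every contraction `V`
satisfies `Re Tr √σ √ρ V ≤ √ε`. -/
lemma IsState.re_trace_sqrt_mul_le {n : Type*} [Fintype n] [DecidableEq n] {ρ σ P V : Matrix n n ℂ}
    {ε : ℝ} (hρ : IsState ρ) (hσ : IsState σ) (hPh : P.IsHermitian) (hP : P * P = P)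
    (h : (P * σ).trace.re + ((1 - P) * ρ).trace.re ≤ ε / 2) (hV : V.conjTranspose * V ≤ 1) :
    (CFC.sqrt σ * (CFC.sqrt ρ * V)).trace.re ≤ √ε := by
  obtain ⟨hQh, hQ⟩ := Matrix.one_sub_projection hPh hP
  have hP0 := Matrix.nonneg_of_projection hPh hP
  have hQ0 := Matrix.nonneg_of_projection hQh hQ
  have ha := Matrix.re_trace_mul_nonneg hP0 hσ.nonneg
  have hb := Matrix.re_trace_mul_nonneg hQ0 hρ.nonneg
  set Q := 1 - P with hQdef
  set R := CFC.sqrt ρ with hR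
  set S := CFC.sqrt σ with hS
  have hRR : R * R = ρ := CFC.sqrt_mul_sqrt_self ρ hρ.nonneg
  have hSS : S * S = σ := CFC.sqrt_mul_sqrt_self σ hσ.nonneg
  have hRh : R.conjTranspose = R := (CFC.sqrt_nonneg ρ).isSelfAdjoint
  have hSh : S.conjTranspose = S := (CFC.sqrt_nonneg σ).isSelfAdjoint
  -- Write `SRV = SPRV + SQRV`. In the first term `P` goes with `√σ`, in the second `Q` goes with
  -- `√ρ`, so each Cauchy–Schwarz bound has one small error factor and one factor at most `1`.
  have c1 := Matrix.re_trace_conjTranspose_mul_le (P * S) (R * V)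
  have c2 := Matrix.re_trace_conjTranspose_mul_le (V * S).conjTranspose (Q * R)
  have e1 : ((P * S).conjTranspose * (P * S)).trace = (P * σ).trace := by
    rw [Matrix.conjTranspose_mul, hSh, hPh.eq, mul_assoc, ← mul_assoc P P, hP,
      Matrix.trace_mul_comm, mul_assoc, hSS]
  have e2 : ((R * V).conjTranspose * (R * V)).trace = (ρ * (V * V.conjTranspose)).trace := by
    rw [Matrix.conjTranspose_mul, hRh, mul_assoc, ← mul_assoc R R, hRR, Matrix.trace_mul_comm,
      mul_assoc]
  have e3 : ((Q * R).conjTranspose * (Q * R)).trace = (Q * ρ).trace := by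
    rw [Matrix.conjTranspose_mul, hRh, hQh.eq, mul_assoc, ← mul_assoc Q Q, hQ,
      Matrix.trace_mul_comm, mul_assoc, hRR]
  have e4 : ((V * S) * (V * S).conjTranspose).trace = (σ * (V.conjTranspose * V)).trace := by
    rw [Matrix.conjTranspose_mul, hSh, mul_assoc, ← mul_assoc S S, hSS, Matrix.trace_mul_comm,
      mul_assoc]
  have e5 : (S * (R * V)).trace = ((P * S).conjTranspose * (R * V)).trace +
      (V * S * (Q * R)).trace := by
    rw [Matrix.conjTranspose_mul, hSh, hPh.eq, mul_assoc V, Matrix.trace_mul_comm V,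
      ← Matrix.trace_add]
    congr 1
    rw [hQdef]
    noncomm_ring
  have b1 := Matrix.re_trace_mul_le hρ.nonneg (Matrix.mul_conjTranspose_le_one hV)
  have b2 := Matrix.re_trace_mul_le hσ.nonneg hV
  rw [hρ.re_trace] at b1
  rw [hσ.re_trace] at b2
  rw [e1, e2] at c1
  rw [Matrix.conjTranspose_conjTranspose, e4, e3] at c2
  rw [e5, Complex.add_re]
  set a := (P * σ).trace.re
  set b := (Q * ρ).trace.re
  have d1 := mul_le_of_le_one_right (Real.sqrt_nonneg a) (Real.sqrt_le_one.2 b1)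
  have d2 := mul_le_of_le_one_left (Real.sqrt_nonneg b) (Real.sqrt_le_one.2 b2)
  have hab : √a + √b ≤ √ε := by
    apply Real.le_sqrt_of_sq_le
    nlinarith [Real.sq_sqrt ha, Real.sq_sqrt hb, sq_nonneg (√a - √b)]
  linarith

/-! ### Mixtures of arbitrary states -/

/-- The square root of a mixture `∑ i, p i • ρ i` is `∑ i, √(p i) • √(ρ i) * V i` for suitable
contractions `V i`. -/
lemma exists_sqrt_sum_eq {n ι : Type*} [Fintype n] [DecidableEq n] [Fintype ι]
    {ρ : ι → Matrix n n ℂ} (h : ∀ i, 0 ≤ ρ i) {p : ι → ℝ} (hp : ∀ i, 0 ≤ p i) :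
    ∃ V : ι → Matrix n n ℂ, (∀ i, (V i).conjTranspose * V i ≤ 1) ∧
      CFC.sqrt (∑ i, p i • ρ i) = ∑ i, √(p i) • (CFC.sqrt (ρ i) * V i) := by
  set τ := ∑ i, p i • ρ i with hτ
  have hterm : ∀ i, 0 ≤ p i • ρ i := fun i => Matrix.smul_nonneg_real (hp i) (h i)
  have hτ0 : 0 ≤ τ := Finset.sum_nonneg fun i _ => hterm i
  have hsa : IsSelfAdjoint τ := hτ0.isSelfAdjoint
  have hcont : ∀ f : ℝ → ℝ, ContinuousOn f (spectrum ℝ τ) :=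
    fun f => τ.finite_real_spectrum.continuousOn f
  -- `g` is `τ^(-1/2)` on the support of `τ` and, since `0⁻¹ = 0`, vanishes on its kernel. So `τg =
  -- √τ` holds without invertibility, and `gτg` is the support projection.
  set g := cfc (fun x : ℝ => (√x)⁻¹) τ with hg
  have hgh : g.conjTranspose = g := cfc_predicate (fun x : ℝ => (√x)⁻¹) τ
  have hgτ : τ * g = CFC.sqrt τ := by
    rw [CFC.sqrt_eq_real_sqrt τ hτ0, cfcₙ_eq_cfc Real.continuous_sqrt.continuousOn Real.sqrt_zero]
    nth_rw 1 [← cfc_id' ℝ τ]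
    rw [hg, ← cfc_mul _ _ τ (hcont _) (hcont _)]
    refine cfc_congr fun x hx => ?_
    have hx0 : 0 ≤ x := spectrum_nonneg_of_nonneg hτ0 hx
    rw [← div_eq_mul_inv, Real.div_sqrt]
  have hgτg : g * τ * g ≤ 1 := by
    have : g * τ * g = cfc (fun x : ℝ => (√x)⁻¹ * x * (√x)⁻¹) τ := by
      rw [cfc_mul _ _ τ (hcont _) (hcont _), cfc_mul _ _ τ (hcont _) (hcont _), cfc_id' ℝ τ]
    rw [this]
    refine cfc_le_one _ τ fun x hx => ?_
    have hx0 : 0 ≤ x := spectrum_nonneg_of_nonneg hτ0 hx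
    rw [mul_assoc, ← div_eq_mul_inv, Real.div_sqrt]
    exact inv_mul_le_one
  refine ⟨fun i => √(p i) • (CFC.sqrt (ρ i) * g), fun i => ?_, ?_⟩
  · have e : (√(p i) • (CFC.sqrt (ρ i) * g)).conjTranspose * (√(p i) • (CFC.sqrt (ρ i) * g)) =
        g * (p i • ρ i) * g := by
      have hs : (CFC.sqrt (ρ i)).conjTranspose = CFC.sqrt (ρ i) :=
        (CFC.sqrt_nonneg (ρ i)).isSelfAdjoint
      rw [Matrix.conjTranspose_smul, Matrix.conjTranspose_mul, hs, hgh, star_trivial,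
        smul_mul_smul_comm, Real.mul_self_sqrt (hp i), mul_smul_comm, smul_mul_assoc]
      congr 1
      rw [mul_assoc g, ← mul_assoc _ _ g, CFC.sqrt_mul_sqrt_self (ρ i) (h i), mul_assoc]
    have hle : p i • ρ i ≤ τ := Finset.single_le_sum (fun j _ => hterm j) (Finset.mem_univ i)
    rw [e]
    refine le_trans ?_ hgτg
    have := IsSelfAdjoint.conjugate_le_conjugate hle (show IsSelfAdjoint g from hgh)
    exact this
  · rw [← hgτ, hτ, Finset.sum_mul]
    refine Finset.sum_congr rfl fun i _ => ?_
    rw [mul_smul_comm, smul_smul, Real.mul_self_sqrt (hp i), ← mul_assoc,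
      CFC.sqrt_mul_sqrt_self (ρ i) (h i), smul_mul_assoc]

lemma sum_sqrt_le_sqrt_card {ι : Type*} [Fintype ι] {p : ι → ℝ} (hp : ∀ i, 0 ≤ p i)
    (hp1 : ∑ i, p i = 1) : ∑ i, √(p i) ≤ √(Fintype.card ι) := by
  apply Real.le_sqrt_of_sq_le
  have := sq_sum_le_card_mul_sum_sq (s := Finset.univ) (f := fun i => √(p i))
  simpa [Real.sq_sqrt (hp _), hp1] using this

/-- The reverse triangle inequality for arbitrary states. -/
theorem two_sub_two_mul_sqrt_le_traceNorm {n ι : Type*} [Fintype n] [DecidableEq n] [Fintype ι]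
    {ρ : ι → Matrix n n ℂ} {σ : Matrix n n ℂ} {ε : ℝ}
    (hρ : ∀ i, IsState (ρ i)) (hσ : IsState σ) (h : ∀ i, 2 - ε ≤ traceNorm (ρ i - σ))
    {p : ι → ℝ} (hp : ∀ i, 0 ≤ p i) (hp1 : ∑ i, p i = 1) :
    2 - 2 * √(Fintype.card ι * ε) ≤ traceNorm (∑ i, p i • ρ i - σ) := by
  have hτ := IsState.sum hρ hp hp1
  obtain ⟨V, hV, hsum⟩ := exists_sqrt_sum_eq (fun i => (hρ i).nonneg) hp
  have hps := powers_stormer (CFC.sqrt_nonneg (∑ i, p i • ρ i)) (CFC.sqrt_nonneg σ)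
  rw [CFC.sqrt_mul_sqrt_self _ hτ.nonneg, CFC.sqrt_mul_sqrt_self _ hσ.nonneg, hτ.re_trace,
    hσ.re_trace] at hps
  have key : (CFC.sqrt (∑ i, p i • ρ i) * CFC.sqrt σ).trace.re ≤ √(Fintype.card ι * ε) := by
    rw [Matrix.trace_mul_comm, hsum, Finset.mul_sum, Matrix.trace_sum, Complex.re_sum]
    calc ∑ i, (CFC.sqrt σ * √(p i) • (CFC.sqrt (ρ i) * V i)).trace.re ≤ ∑ i, √(p i) * √ε := by
          refine Finset.sum_le_sum fun i _ => ?_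
          obtain ⟨P, hPh, hP, -, hle⟩ := (hρ i).exists_projection hσ (h i)
          rw [mul_smul_comm, Matrix.trace_smul, Complex.smul_re, smul_eq_mul]
          exact mul_le_mul_of_nonneg_left
            ((hρ i).re_trace_sqrt_mul_le hσ hPh hP hle (hV i)) (Real.sqrt_nonneg _)
      _ ≤ √(Fintype.card ι * ε) := by
          rw [← Finset.sum_mul, Real.sqrt_mul (Nat.cast_nonneg _)]
          exact mul_le_mul_of_nonneg_right (sum_sqrt_le_sqrt_card hp hp1) (Real.sqrt_nonneg _)
  linarith

/-! ### Commuting states -/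

/-- Finitely many commuting projections have an upper bound `T ≤ 1` which is at most their sum. -/
lemma exists_commuting_join {n ι : Type*} [Fintype n] [DecidableEq n]
    {P : ι → Matrix n n ℂ} (hPh : ∀ i, (P i).IsHermitian) (hP : ∀ i, P i * P i = P i)
    (hc : ∀ i j, Commute (P i) (P j)) (s : Finset ι) :
    ∃ T : Matrix n n ℂ, 0 ≤ T ∧ T ≤ 1 ∧ T ≤ ∑ i ∈ s, P i ∧ (∀ i ∈ s, P i ≤ T) ∧
      ∀ j, Commute T (P j) := by
  classical
  induction s using Finset.induction_on with
  | empty => exact ⟨0, le_rfl, zero_le_one, by simp, by simp, fun j => Commute.zero_left _⟩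
  | insert a s ha ih =>
    obtain ⟨T, h0, h1, hle, hge, hcT⟩ := ih
    have conj : ∀ {X Q : Matrix n n ℂ}, 0 ≤ X → Q.IsHermitian → Q * Q = Q → Commute X Q →
        0 ≤ X * Q := fun {X Q} hX hQh hQ hXQ => by
      have := IsSelfAdjoint.conjugate_nonneg hX (show IsSelfAdjoint Q from hQh)
      rwa [← hXQ.eq, mul_assoc, hQ] at this
    obtain ⟨hQh, hQ⟩ := Matrix.one_sub_projection (hPh a) (hP a)
    have hcT' : Commute T (1 - P a) := (Commute.one_right T).sub_right (hcT a)
    have n1 := conj h0 (hPh a) (hP a) (hcT a)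
    have n2 := conj h0 hQh hQ hcT'
    have n3 := conj (sub_nonneg.2 h1) (hPh a) (hP a) ((Commute.one_left _).sub_left (hcT a))
    have n4 := conj (sub_nonneg.2 h1) hQh hQ ((Commute.one_left _).sub_left hcT')
    have hTT : T ≤ T + (1 - T) * P a := le_add_of_nonneg_right n3
    -- The join is `1 - (1 - T)(1 - P a)`. Every required inequality reduces to positivity of one of
    -- the four products of `T` or `1 - T` with `P a` or `1 - P a`.
    refine ⟨T + (1 - T) * P a, add_nonneg h0 n3, ?_, ?_, ?_, fun j => ?_⟩
    · rw [← sub_nonneg]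
      convert n4 using 1
      noncomm_ring
    · rw [Finset.sum_insert ha, add_comm (P a)]
      refine add_le_add hle ?_
      rw [← sub_nonneg]
      convert n1 using 1
      noncomm_ring
    · intro i hi
      rcases Finset.mem_insert.1 hi with rfl | hi
      · rw [← sub_nonneg]
        convert n2 using 1
        noncomm_ring
      · exact (hge i hi).trans hTT
    · exact (hcT j).add_left (((Commute.one_left _).sub_left (hcT j)).mul_left (hc a j))

/-- The reverse triangle inequality for commuting states. -/
theorem two_sub_card_mul_le_traceNorm_of_commute {n ι : Type*} [Fintype n] [DecidableEq n]
    [Fintype ι] {ρ : ι → Matrix n n ℂ} {σ : Matrix n n ℂ} {ε : ℝ}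
    (hρ : ∀ i, IsState (ρ i)) (hσ : IsState σ) (h : ∀ i, 2 - ε ≤ traceNorm (ρ i - σ))
    (hcρ : ∀ i j, Commute (ρ i) (ρ j)) (hcσ : ∀ i, Commute (ρ i) σ)
    {p : ι → ℝ} (hp : ∀ i, 0 ≤ p i) (hp1 : ∑ i, p i = 1) :
    2 - Fintype.card ι * ε ≤ traceNorm (∑ i, p i • ρ i - σ) := by
  choose P hPh hP hc herr using fun i => (hρ i).exists_projection hσ (h i)
  have hPP : ∀ i j, Commute (P i) (P j) := fun i j => by
    have hH : ∀ k, Commute (ρ j - σ) (ρ k - σ) := fun k =>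
      ((hcρ j k).sub_right (hcσ j)).sub_left ((hcσ k).symm.sub_right (Commute.refl σ))
    exact hc j _ (hc i _ (hH i)).symm
  obtain ⟨T, h0, h1, hle, hge, -⟩ := exists_commuting_join hPh hP hPP Finset.univ
  have mono : ∀ {X Y A : Matrix n n ℂ}, 0 ≤ A → X ≤ Y → (X * A).trace.re ≤ (Y * A).trace.re :=
    fun {X Y A} hA hXY => by
      have := Matrix.re_trace_mul_nonneg (sub_nonneg.2 hXY) hA
      rw [sub_mul, Matrix.trace_sub, Complex.sub_re] at this
      linarith
  have a1 := mono hσ.nonneg hle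
  rw [Finset.sum_mul, Matrix.trace_sum, Complex.re_sum] at a1
  have b0 : ∀ i, 0 ≤ ((1 - P i) * ρ i).trace.re := fun i =>
    Matrix.re_trace_mul_nonneg (sub_nonneg.2 (Matrix.projection_le_one (hPh i) (hP i))) (hρ i).nonneg
  -- The weights are discarded using `p i ≤ 1`, since the errors on `σ` add up unweighted and each
  -- pair must recombine to at most `ε/2`.
  have a2 : ((1 - T) * ∑ i, p i • ρ i).trace.re ≤ ∑ i, ((1 - P i) * ρ i).trace.re := by
    rw [Finset.mul_sum, Matrix.trace_sum, Complex.re_sum]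
    refine Finset.sum_le_sum fun i _ => ?_
    rw [mul_smul_comm, Matrix.trace_smul, Complex.smul_re, smul_eq_mul]
    have hp_le : p i ≤ 1 := hp1 ▸ Finset.single_le_sum (fun j _ => hp j) (Finset.mem_univ i)
    exact (mul_le_mul_of_nonneg_left (mono (hρ i).nonneg (sub_le_sub_left (hge i (Finset.mem_univ i)) 1))
      (hp i)).trans (mul_le_of_le_one_left (b0 i) hp_le)
  have hsum := Finset.sum_le_sum fun i (_ : i ∈ Finset.univ) => herr i
  rw [Finset.sum_add_distrib, Finset.sum_const, Finset.card_univ, nsmul_eq_mul] at hsum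
  have := (IsState.sum hρ hp hp1).le_traceNorm_sub hσ h0 h1 ((add_le_add a1 a2).trans hsum)
  linarith

/-! ### The non-commuting example -/

/-- The rank-one matrix `v vᵀ` of the real vector `v = (c, s, 0)`. -/
noncomputable def realPure (c s : ℝ) : Matrix (Fin 3) (Fin 3) ℂ :=
  Matrix.vecMulVec ![(c : ℂ), s, 0] ![(c : ℂ), s, 0]

lemma realPure_isHermitian (c s : ℝ) : (realPure c s).IsHermitian := by
  ext i j
  fin_cases i <;> fin_cases j <;> simp [realPure, Matrix.vecMulVec, mul_comm]

lemma realPure_mul_self {c s : ℝ} (h : c ^ 2 + s ^ 2 = 1) :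
    realPure c s * realPure c s = realPure c s := by
  have h' : (c : ℂ) * c + s * s = 1 := by exact_mod_cast (by linarith : c * c + s * s = 1)
  have hd : ![(c : ℂ), s, 0] ⬝ᵥ ![(c : ℂ), s, 0] = 1 := by simp [h']
  rw [realPure, Matrix.vecMulVec_mul_vecMulVec, hd, one_smul]

lemma realPure_isState {c s : ℝ} (h : c ^ 2 + s ^ 2 = 1) : IsState (realPure c s) where
  posSemidef := Matrix.nonneg_iff_posSemidef.1
    (Matrix.nonneg_of_projection (realPure_isHermitian c s) (realPure_mul_self h))
  trace_eq_one := by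
    have h' : (c : ℂ) * c + s * s = 1 := by exact_mod_cast (by linarith : c * c + s * s = 1)
    simp [realPure, Matrix.trace_fin_three, Matrix.vecMulVec, h']

/-- The diagonal matrix with real entries `u, q, w`. -/
noncomputable def realDiag (u q w : ℝ) : Matrix (Fin 3) (Fin 3) ℂ :=
  Matrix.diagonal ![(u : ℂ), q, w]

lemma realDiag_nonneg {u q w : ℝ} (hu : 0 ≤ u) (hq : 0 ≤ q) (hw : 0 ≤ w) : 0 ≤ realDiag u q w := by
  refine Matrix.nonneg_iff_posSemidef.2 (Matrix.PosSemidef.diagonal fun i => ?_)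
  fin_cases i <;> simpa

lemma realDiag_re_trace (u q w : ℝ) : (realDiag u q w).trace.re = u + q + w := by
  simp [realDiag, Fin.sum_univ_three]

lemma realDiag_isState {u q w : ℝ} (hu : 0 ≤ u) (hq : 0 ≤ q) (hw : 0 ≤ w) (h : u + q + w = 1) :
    IsState (realDiag u q w) where
  posSemidef := Matrix.nonneg_iff_posSemidef.1 (realDiag_nonneg hu hq hw)
  trace_eq_one := by
    simp only [realDiag, Matrix.trace_diagonal, Fin.sum_univ_three]
    simpa using (by exact_mod_cast h : (u : ℂ) + q + w = 1)

lemma le_traceNorm_realPure_sub_realDiag {c s u q w x y ε : ℝ} (hcs : c ^ 2 + s ^ 2 = 1)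
    (hu : 0 ≤ u) (hq : 0 ≤ q) (hw : 0 ≤ w) (huqw : u + q + w = 1) (hxy : x ^ 2 + y ^ 2 = 1)
    (h : 1 - ε / 2 ≤ (x * c + y * s) ^ 2 - u * x ^ 2 - q * y ^ 2) :
    2 - ε ≤ traceNorm (realPure c s - realDiag u q w) := by
  have hT := realPure_isHermitian x y
  have hTT := realPure_mul_self hxy
  have e1 : (realPure x y * realPure c s).trace.re = (x * c + y * s) ^ 2 := by
    simp [realPure, Matrix.trace_fin_three, Matrix.mul_apply, Fin.sum_univ_three, Matrix.vecMulVec]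
    ring
  have e2 : (realPure x y * realDiag u q w).trace.re = u * x ^ 2 + q * y ^ 2 := by
    simp [realPure, realDiag, Matrix.trace_fin_three, Matrix.vecMulVec]
    ring
  have key := (realPure_isState hcs).le_traceNorm_sub (realDiag_isState hu hq hw huqw)
    (Matrix.nonneg_of_projection hT hTT) (Matrix.projection_le_one hT hTT) (δ := ε / 2) (by
      rw [sub_mul, one_mul, Matrix.trace_sub, Complex.sub_re, e1, e2,
        (realPure_isState hcs).re_trace]
      linarith)
  linarith

/-- Two rank-one projections commute only if their vectors are parallel (`cs = 0`) or orthogonal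
(`c² = s²`). -/
lemma not_commute_realPure_neg {c s : ℝ} (h : c * s * (c ^ 2 - s ^ 2) ≠ 0) :
    ¬ Commute (realPure c s) (realPure c (-s)) := fun hc => by
  have := congrArg Complex.re (congrFun (congrFun hc.eq 0) 1)
  simp [realPure, Matrix.mul_apply, Fin.sum_univ_three, Matrix.vecMulVec] at this
  apply h
  linarith

lemma not_commute_realPure_realDiag {c s u q w : ℝ} (h : c * s * (u - q) ≠ 0) :
    ¬ Commute (realPure c s) (realDiag u q w) := fun hc => by
  have := congrArg Complex.re (congrFun (congrFun hc.eq 0) 1)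
  simp [realPure, realDiag, Matrix.vecMulVec] at this
  apply h
  linarith

/-- Averaging cancels the off-diagonal entries, leaving a difference of two positive diagonal
matrices, each of trace `w`. -/
lemma traceNorm_mid_sub_realDiag_le {c s u q w : ℝ} (hcs : c ^ 2 + s ^ 2 = 1)
    (huc : u ≤ c ^ 2) (hqs : q ≤ s ^ 2) (hw : 0 ≤ w) (huqw : u + q + w = 1) :
    traceNorm ((1 / 2 : ℝ) • (realPure c s + realPure c (-s)) - realDiag u q w) ≤ 2 * w := by
  have e : (1 / 2 : ℝ) • (realPure c s + realPure c (-s)) - realDiag u q w =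
      realDiag (c ^ 2 - u) (s ^ 2 - q) 0 - realDiag 0 0 w := by
    ext i j
    fin_cases i <;> fin_cases j <;>
      simp [realPure, realDiag, Matrix.vecMulVec] <;> ring
  rw [e]
  refine (traceNorm_sub_le (realDiag_nonneg (sub_nonneg.2 huc) (sub_nonneg.2 hqs) le_rfl)
    (realDiag_nonneg le_rfl le_rfl hw)).trans ?_
  rw [realDiag_re_trace, realDiag_re_trace]
  linarith

/-- The states `(c, ±s, 0)` and `diag (u, q, w)` attain `2 - √(2ε)`, when the test `(x, ±y, 0)`
certifies that they are at distance at least `2 - ε`. -/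
lemma exists_states_of_parameters {ε c s u q w x y : ℝ} (hcs : c ^ 2 + s ^ 2 = 1) (hu : 0 ≤ u)
    (hq : 0 ≤ q) (hw : 0 ≤ w) (huqw : u + q + w = 1) (huc : u ≤ c ^ 2) (hqs : q ≤ s ^ 2)
    (hxy : x ^ 2 + y ^ 2 = 1) (h : 1 - ε / 2 ≤ (x * c + y * s) ^ 2 - u * x ^ 2 - q * y ^ 2)
    (hw' : 2 * w ≤ 2 - √(2 * ε)) (hne : c * s * (c ^ 2 - s ^ 2) ≠ 0)
    (hne' : 0 < ε → c * s * (u - q) ≠ 0) :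
    ∃ (d : ℕ) (ρ₁ ρ₂ σ : Matrix (Fin d) (Fin d) ℂ),
      IsState ρ₁ ∧ IsState ρ₂ ∧ IsState σ ∧
      ¬ Commute ρ₁ ρ₂ ∧ (0 < ε → ¬ Commute ρ₁ σ ∧ ¬ Commute ρ₂ σ) ∧
      2 - ε ≤ traceNorm (ρ₁ - σ) ∧ 2 - ε ≤ traceNorm (ρ₂ - σ) ∧
      traceNorm ((1 / 2 : ℝ) • (ρ₁ + ρ₂) - σ) ≤ 2 - √(2 * ε) := by
  have hcs' : c ^ 2 + (-s) ^ 2 = 1 := by linarith [neg_sq s]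
  refine ⟨3, realPure c s, realPure c (-s), realDiag u q w, realPure_isState hcs,
    realPure_isState hcs', realDiag_isState hu hq hw huqw, not_commute_realPure_neg hne,
    fun hε => ⟨not_commute_realPure_realDiag (hne' hε), not_commute_realPure_realDiag ?_⟩,
    le_traceNorm_realPure_sub_realDiag hcs hu hq hw huqw hxy h,
    le_traceNorm_realPure_sub_realDiag hcs' hu hq hw huqw (x := x) (y := -y) (by linarith [neg_sq y])
      ?_, (traceNorm_mid_sub_realDiag_le hcs huc hqs hw huqw).trans hw'⟩
  · simpa using hne' hε
  · rwa [neg_mul_neg, neg_sq]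

lemma exists_noncommuting_states {ε : ℝ} (h0 : 0 ≤ ε) (h2 : ε ≤ 2) :
    ∃ (d : ℕ) (ρ₁ ρ₂ σ : Matrix (Fin d) (Fin d) ℂ),
      IsState ρ₁ ∧ IsState ρ₂ ∧ IsState σ ∧
      ¬ Commute ρ₁ ρ₂ ∧ (0 < ε → ¬ Commute ρ₁ σ ∧ ¬ Commute ρ₂ σ) ∧
      2 - ε ≤ traceNorm (ρ₁ - σ) ∧ 2 - ε ≤ traceNorm (ρ₂ - σ) ∧
      traceNorm ((1 / 2 : ℝ) • (ρ₁ + ρ₂) - σ) ≤ 2 - √(2 * ε) := by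
  obtain ⟨q, hq, rfl⟩ : ∃ q : ℝ, 0 ≤ q ∧ ε = 2 * q ^ 2 :=
    ⟨√(ε / 2), Real.sqrt_nonneg _, by rw [Real.sq_sqrt (by linarith)]; ring⟩
  have hq1 : q ≤ 1 := by nlinarith
  have hsqrt : √(2 * (2 * q ^ 2)) = 2 * q := by
    rw [show 2 * (2 * q ^ 2) = (2 * q) ^ 2 by ring, Real.sqrt_sq (by linarith)]
  -- The generic choice `c² = 1 - q`, `s² = q` gives commuting pure states exactly when `q` is `0`,
  -- `1` or `1/2`; these values need other witnesses.
  by_cases hq0 : q = 0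
  · subst hq0
    apply exists_states_of_parameters (c := 4 / 5) (s := 3 / 5) (u := 0) (q := 0) (w := 1)
      (x := 4 / 5) (y := 3 / 5) <;> norm_num
  by_cases hq1' : q = 1
  · subst hq1'
    apply exists_states_of_parameters (c := 4 / 5) (s := 3 / 5) (u := 16 / 25) (q := 9 / 25) (w := 0)
      (x := 4 / 5) (y := 3 / 5) <;> (try rw [hsqrt]) <;> norm_num
  by_cases hq2 : q = 1 / 2
  · subst hq2
    -- Here `s²` is slightly above `1/2`. The pure state itself would fall short as a test, so the
    -- test is tilted away from the second axis.
    apply exists_states_of_parameters (c := 20 / 29) (s := 21 / 29) (u := 0) (q := 1 / 2) (w := 1 / 2)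
      (x := 4 / 5) (y := 3 / 5) <;> (try rw [hsqrt]) <;> norm_num
  have hqpos : 0 < q := lt_of_le_of_ne hq (Ne.symm hq0)
  have hqlt : 0 < 1 - q := sub_pos.2 (lt_of_le_of_ne hq1 hq1')
  have hc := Real.sq_sqrt hqlt.le
  have hs := Real.sq_sqrt hq
  have hcs : √(1 - q) ^ 2 + √q ^ 2 = 1 := by linarith
  have hne : √(1 - q) * √q ≠ 0 := (mul_pos (Real.sqrt_pos.2 hqlt) (Real.sqrt_pos.2 hqpos)).ne'
  -- Each pure state serves as its own test: its overlap with `σ` is `q s² = q² = ε/2`. The midpoint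
  -- is at distance at most `2(1 - q) = 2 - √(2ε)`.
  refine exists_states_of_parameters (c := √(1 - q)) (s := √q) (u := 0) (q := q) (w := 1 - q)
    (x := √(1 - q)) (y := √q) hcs le_rfl hq hqlt.le (by ring) (by positivity) hs.ge hcs ?_ ?_ ?_ ?_
  · rw [← sq, ← sq, hcs, hs]
    linarith
  · rw [hsqrt]; linarith
  · refine mul_ne_zero hne ?_
    rw [hc, hs]
    intro h
    apply hq2
    linarith
  · intro _
    refine mul_ne_zero hne ?_
    simpa using hq0

theorem theorem2 :
    -- 1) arbitrary states
    (∀ (d l : ℕ) (ε : ℝ) (ρ : Fin l → Matrix (Fin d) (Fin d) ℂ) (σ : Matrix (Fin d) (Fin d) ℂ),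
      0 ≤ ε → (∀ i, IsState (ρ i)) → IsState σ → (∀ i, 2 - ε ≤ traceNorm (ρ i - σ)) →
      ∀ p : Fin l → ℝ, (∀ i, 0 ≤ p i) → ∑ i, p i = 1 →
        2 - 2 * Real.sqrt (l * ε) ≤ traceNorm (∑ i, p i • ρ i - σ)) ∧
    -- 2) commuting states
    (∀ (d l : ℕ) (ε : ℝ) (ρ : Fin l → Matrix (Fin d) (Fin d) ℂ) (σ : Matrix (Fin d) (Fin d) ℂ),
      0 ≤ ε → (∀ i, IsState (ρ i)) → IsState σ → (∀ i, 2 - ε ≤ traceNorm (ρ i - σ)) →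
      (∀ i j, Commute (ρ i) (ρ j)) → (∀ i, Commute (ρ i) σ) →
      ∀ p : Fin l → ℝ, (∀ i, 0 ≤ p i) → ∑ i, p i = 1 →
        2 - l * ε ≤ traceNorm (∑ i, p i • ρ i - σ)) ∧
    -- 3) non-commuting states (pairwise non-commuting when `ε > 0`) attaining order `√ε`
    (∀ ε : ℝ, 0 ≤ ε → ε ≤ 2 →
      ∃ (d : ℕ) (ρ₁ ρ₂ σ : Matrix (Fin d) (Fin d) ℂ),
        IsState ρ₁ ∧ IsState ρ₂ ∧ IsState σ ∧
        ¬ Commute ρ₁ ρ₂ ∧ (0 < ε → ¬ Commute ρ₁ σ ∧ ¬ Commute ρ₂ σ) ∧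
        2 - ε ≤ traceNorm (ρ₁ - σ) ∧ 2 - ε ≤ traceNorm (ρ₂ - σ) ∧
        traceNorm ((1 / 2 : ℝ) • (ρ₁ + ρ₂) - σ) ≤ 2 - Real.sqrt (2 * ε)) ∧
    -- hence, already for `l = 2`, no dimension-free lower bound is better than `2 - √(2ε)`
    (∀ φ : ℝ → ℝ,
      (∀ (ε : ℝ) (d : ℕ) (ρ₁ ρ₂ σ : Matrix (Fin d) (Fin d) ℂ), 0 ≤ ε → ε ≤ 2 →
        IsState ρ₁ → IsState ρ₂ → IsState σ →
        2 - ε ≤ traceNorm (ρ₁ - σ) → 2 - ε ≤ traceNorm (ρ₂ - σ) →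
        2 - φ ε ≤ traceNorm ((1 / 2 : ℝ) • (ρ₁ + ρ₂) - σ)) →
      ∀ ε : ℝ, 0 ≤ ε → ε ≤ 2 → Real.sqrt (2 * ε) ≤ φ ε) := by
  refine ⟨fun d l ε ρ σ _ hρ hσ h p hp hp1 => ?_, fun d l ε ρ σ _ hρ hσ h hcρ hcσ p hp hp1 => ?_,
    fun ε h0 h2 => exists_noncommuting_states h0 h2, fun φ hφ ε h0 h2 => ?_⟩
  · simpa using two_sub_two_mul_sqrt_le_traceNorm hρ hσ h hp hp1
  · simpa using two_sub_card_mul_le_traceNorm_of_commute hρ hσ h hcρ hcσ hp hp1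
  · obtain ⟨d, ρ₁, ρ₂, σ, h₁, h₂, hσ, -, -, hd₁, hd₂, hle⟩ := exists_noncommuting_states h0 h2
    linarith [hφ ε d ρ₁ ρ₂ σ h0 h2 h₁ h₂ hσ hd₁ hd₂]
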